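/- \textbf{Definitions.} Let $G$ be a group with identity $e$ and $R$ an associative ring with identity. A \emph{unital twisted partial action} of $G$ on $R$ is a triple $\alpha=(\{D_g\}_{g\in G},\{\alpha_g\}_{g\in G},\{w_{g,h}\}_{(g,h)\in G\times G})$, where each $D_g$ is a two-sided ideal of $R$ generated by a central idempotent $1_g$, each $\alpha_g:D_{g^{-1}}\to D_g$ is a ring isomorphism, and each $w_{g,h}$ is an invertible element of the ring $D_gD_{gh}$ (whose identity is $1_g1_{gh}$), such that for all $g,h,t\in G$: (i) $D_e=R$ and $\alpha_e=\mathrm{id}_R$; (ii) $\alpha_g(D_{g^{-1}}D_h)=D_gD_{gh}$; (iii) $\alpha_g(\alpha_h(a))=w_{g,h}\,\alpha_{gh}(a)\,w_{g,h}^{-1}$ for all $a\in D_{h^{-1}}D_{h^{-1}g^{-1}}$; (iv) $w_{g,e}=w_{e,g}=1_g$; (v) $\alpha_g(a\,w_{h,t})\,w_{g,ht}=\alpha_g(a)\,w_{g,h}\,w_{gh,t}$ for all $a\in D_{g^{-1}}D_hD_{ht}$. The \emph{partial crossed product} $R*_{\alpha,w}G$ is the direct sum $\bigoplus_{g\in G}D_g\delta_g$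 with the biadditive multiplication determined by $(a_g\delta_g)(b_h\delta_h)=\alpha_g(\alpha_g^{-1}(a_g)\,b_h)\,w_{g,h}\,\delta_{gh}$; it is an associative ring with identity $1_R\delta_e$. A ring $S$ with Jacobson radical $J(S)$ is \emph{semilocal} if $S/J(S)$ is semisimple. \textbf{Theorem.} Let $\alpha$ be a unital twisted partial action of a finite group $G$ on an associative ring $R$ with identity. Then $R$ is semilocal if and only if $R*_{\alpha,w}G$ is semilocal. -/

import Mathlib

open scoped DirectSum

/-- A ring `S` is semilocal if `S / J(S)` is semisimple, with `J(S)` the Jacobson radical. -/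
def IsSemilocalRing (S : Type*) [Ring S] : Prop :=
  IsSemisimpleRing (S ⧸ Ring.jacobson S)

/-- A unital twisted partial action of a group `G` on a ring `R`.
Products of ideals such as `D_g D_h` are Mathlib's products of (left) ideals.
The side conditions `h₁`, `h₂`, `h₃` in `α_comp` and `cocycle` only serve to apply `α_g` to
elements of its domain: each of them follows from the membership `ha` and the other fields
(see `mem_dom_of_comp` and `mem_dom_of_cocycle` below), so they restrict nothing. -/
structure UnitalTwistedPartialAction (G R : Type*) [Group G] [Ring R] where
  /-- the two-sided ideal `D_g` -/
  D : G → TwoSidedIdeal R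
  /-- the central idempotent `1_g` generating `D_g` -/
  e : G → R
  e_idem : ∀ g, IsIdempotentElem (e g)
  e_central : ∀ g, e g ∈ Set.center R
  D_eq_span : ∀ g, D g = TwoSidedIdeal.span {e g}
  /-- the ring isomorphism `α_g : D_{g⁻¹} → D_g` -/
  α : ∀ g, D g⁻¹ ≃+* D g
  /-- the twisting element `w_{g,h}`, a unit of the ring `D_g D_{gh}` (whose identity is
  `1_g 1_{gh}`) -/
  w : G → G → R
  /-- the inverse of `w_{g,h}` in the ring `D_g D_{gh}` -/
  wInv : G → G → R
  w_mem : ∀ g h, w g h ∈ (D g).asIdeal * (D (g * h)).asIdeal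
  wInv_mem : ∀ g h, wInv g h ∈ (D g).asIdeal * (D (g * h)).asIdeal
  w_mul_wInv : ∀ g h, w g h * wInv g h = e g * e (g * h)
  wInv_mul_w : ∀ g h, wInv g h * w g h = e g * e (g * h)
  D_one : D 1 = ⊤
  α_one : ∀ a : D 1⁻¹, (α 1 a : R) = a
  α_image : ∀ g h,
    (fun a : D g⁻¹ => (α g a : R)) '' {a | (a : R) ∈ (D g⁻¹).asIdeal * (D h).asIdeal} =
      ((D g).asIdeal * (D (g * h)).asIdeal : Ideal R)
  α_comp : ∀ (g h : G) (a : R) (_ha : a ∈ (D h⁻¹).asIdeal * (D (g * h)⁻¹).asIdeal)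
    (h₁ : a ∈ D h⁻¹) (h₂ : (α h ⟨a, h₁⟩ : R) ∈ D g⁻¹) (h₃ : a ∈ D (g * h)⁻¹),
    (α g ⟨α h ⟨a, h₁⟩, h₂⟩ : R) = w g h * α (g * h) ⟨a, h₃⟩ * wInv g h
  w_one_right : ∀ g, w g 1 = e g
  w_one_left : ∀ g, w 1 g = e g
  cocycle : ∀ (g h t : G) (a : R)
    (_ha : a ∈ (D g⁻¹).asIdeal * (D h).asIdeal * (D (h * t)).asIdeal)
    (h₁ : a * w h t ∈ D g⁻¹) (h₂ : a ∈ D g⁻¹),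
    (α g ⟨a * w h t, h₁⟩ : R) * w g (h * t) = α g ⟨a, h₂⟩ * w g h * w (g * h) t

namespace UnitalTwistedPartialAction

variable {G R : Type*} [Group G] [Ring R] (A : UnitalTwistedPartialAction G R)

theorem e_comm (g : G) (x : R) : A.e g * x = x * A.e g :=
  ((Set.mem_center_iff.1 (A.e_central g)).comm x)

theorem e_mem (g : G) : A.e g ∈ A.D g := by
  rw [A.D_eq_span]; exact TwoSidedIdeal.subset_span rfl

theorem mem_D_iff {g : G} {x : R} : x ∈ A.D g ↔ x * A.e g = x := by
  constructor
  · intro hx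
    rw [A.D_eq_span, TwoSidedIdeal.mem_span_iff_mem_addSubgroup_closure] at hx
    induction hx using AddSubgroup.closure_induction with
    | mem y hy =>
      obtain ⟨_, ⟨r, -, _, rfl, rfl⟩, s, -, rfl⟩ := hy
      simp only
      rw [mul_assoc, ← A.e_comm g s, mul_assoc, ← mul_assoc (A.e g), A.e_idem g, mul_assoc]
    | zero => simp
    | add y z _ _ hy hz => rw [add_mul, hy, hz]
    | neg y _ hy => rw [neg_mul, hy]
  · intro hx
    rw [← hx]; exact (A.D g).mul_mem_left _ _ (A.e_mem g)

theorem mul_e {g : G} {x : R} (hx : x ∈ A.D g) : x * A.e g = x := A.mem_D_iff.1 hx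

theorem e_mul {g : G} {x : R} (hx : x ∈ A.D g) : A.e g * x = x := by
  rw [A.e_comm, A.mul_e hx]

theorem mem_mul_iff {g h : G} {x : R} :
    x ∈ (A.D g).asIdeal * (A.D h).asIdeal ↔ x ∈ A.D g ∧ x ∈ A.D h := by
  constructor
  · intro hx
    have h1 : (A.D g).asIdeal * (A.D h).asIdeal ≤ (A.D g).asIdeal := Ideal.mul_le_left
    have h2 : (A.D g).asIdeal * (A.D h).asIdeal ≤ (A.D h).asIdeal := Ideal.mul_le_right
    exact ⟨TwoSidedIdeal.mem_asIdeal.1 (h1 hx), TwoSidedIdeal.mem_asIdeal.1 (h2 hx)⟩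
  · rintro ⟨h1, h2⟩
    rw [← A.mul_e h2]
    exact Ideal.mul_mem_mul h1 (A.e_mem h)

theorem mem_mul_mul_iff {g h t : G} {x : R} :
    x ∈ (A.D g).asIdeal * (A.D h).asIdeal * (A.D t).asIdeal ↔
      x ∈ A.D g ∧ x ∈ A.D h ∧ x ∈ A.D t := by
  constructor
  · intro hx
    have h12 : (A.D g).asIdeal * (A.D h).asIdeal * (A.D t).asIdeal ≤
        (A.D g).asIdeal * (A.D h).asIdeal := Ideal.mul_le_left
    have h3 : (A.D g).asIdeal * (A.D h).asIdeal * (A.D t).asIdeal ≤ (A.D t).asIdeal :=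
      Ideal.mul_le_right
    obtain ⟨h1, h2⟩ := A.mem_mul_iff.1 (h12 hx)
    exact ⟨h1, h2, TwoSidedIdeal.mem_asIdeal.1 (h3 hx)⟩
  · rintro ⟨h1, h2, h3⟩
    rw [← A.mul_e h3]
    exact Ideal.mul_mem_mul (A.mem_mul_iff.2 ⟨h1, h2⟩) (A.e_mem t)

theorem w_mem_left (g h : G) : A.w g h ∈ A.D g := (A.mem_mul_iff.1 (A.w_mem g h)).1

theorem w_mem_right (g h : G) : A.w g h ∈ A.D (g * h) := (A.mem_mul_iff.1 (A.w_mem g h)).2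

theorem α_mem_iff {g h : G} (a : A.D g⁻¹) : (A.α g a : R) ∈ A.D (g * h) ↔ (a : R) ∈ A.D h := by
  constructor
  · intro hx
    have : (A.α g a : R) ∈ ((A.D g).asIdeal * (A.D (g * h)).asIdeal : Ideal R) :=
      A.mem_mul_iff.2 ⟨(A.α g a).2, hx⟩
    rw [← SetLike.mem_coe, ← A.α_image] at this
    obtain ⟨b, hb, hab⟩ := this
    rw [← (A.α g).injective (Subtype.ext hab)]
    exact (A.mem_mul_iff.1 hb).2
  · intro hx
    have : (A.α g a : R) ∈ (((A.D g).asIdeal * (A.D (g * h)).asIdeal : Ideal R) : Set R) := by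
      rw [← A.α_image]
      exact ⟨a, A.mem_mul_iff.2 ⟨a.2, hx⟩, rfl⟩
    exact (A.mem_mul_iff.1 this).2

/-- The side conditions in `α_comp` are automatic. -/
theorem mem_dom_of_comp {g h : G} {a : R}
    (ha : a ∈ (A.D h⁻¹).asIdeal * (A.D (g * h)⁻¹).asIdeal) :
    ∃ h₁ : a ∈ A.D h⁻¹, (A.α h ⟨a, h₁⟩ : R) ∈ A.D g⁻¹ ∧ a ∈ A.D (g * h)⁻¹ := by
  obtain ⟨h1, h2⟩ := A.mem_mul_iff.1 ha
  refine ⟨h1, ?_, h2⟩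
  have := (A.α_mem_iff (g := h) (h := (g * h)⁻¹) ⟨a, h1⟩).2 h2
  rwa [mul_inv_rev, mul_inv_cancel_left] at this

/-- The side conditions in `cocycle` are automatic. -/
theorem mem_dom_of_cocycle {g h t : G} {a : R}
    (ha : a ∈ (A.D g⁻¹).asIdeal * (A.D h).asIdeal * (A.D (h * t)).asIdeal) :
    a * A.w h t ∈ A.D g⁻¹ ∧ a ∈ A.D g⁻¹ := by
  have := (A.mem_mul_mul_iff.1 ha).1
  exact ⟨(A.D g⁻¹).mul_mem_right _ _ this, this⟩

/-- The map `x ↦ α_g (1_{g⁻¹} x)` from `R` to `D_g`. -/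
def T (g : G) (x : R) : R :=
  A.α g ⟨A.e g⁻¹ * x, (A.D g⁻¹).mul_mem_right _ _ (A.e_mem _)⟩

theorem T_mem (g : G) (x : R) : A.T g x ∈ A.D g := (A.α g _).2

theorem T_of_mem {g : G} {x : R} (hx : x ∈ A.D g⁻¹) : A.T g x = A.α g ⟨x, hx⟩ := by
  simp only [T, A.e_mul hx]

theorem T_mul (g : G) (x y : R) : A.T g (x * y) = A.T g x * A.T g y := by
  have : (⟨A.e g⁻¹ * (x * y), (A.D g⁻¹).mul_mem_right _ _ (A.e_mem _)⟩ : A.D g⁻¹) =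
      ⟨A.e g⁻¹ * x, (A.D g⁻¹).mul_mem_right _ _ (A.e_mem _)⟩ *
      ⟨A.e g⁻¹ * y, (A.D g⁻¹).mul_mem_right _ _ (A.e_mem _)⟩ := by
    apply Subtype.ext
    change A.e g⁻¹ * (x * y) = A.e g⁻¹ * x * (A.e g⁻¹ * y)
    rw [mul_assoc, ← mul_assoc x, ← A.e_comm _ x, mul_assoc, ← mul_assoc (A.e g⁻¹) (A.e g⁻¹), A.e_idem]
  unfold T
  rw [this, map_mul]
  rfl

theorem T_e_self (g : G) (x : R) : A.T g (A.e g⁻¹ * x) = A.T g x := by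
  have : A.e g⁻¹ * (A.e g⁻¹ * x) = A.e g⁻¹ * x := by rw [← mul_assoc, A.e_idem]
  simp only [T, this]

theorem exists_T_eq {g : G} {x : R} (hx : x ∈ A.D g) : ∃ y ∈ A.D g⁻¹, A.T g y = x :=
  ⟨(A.α g).symm ⟨x, hx⟩, ((A.α g).symm ⟨x, hx⟩).2, by
    rw [A.T_of_mem ((A.α g).symm ⟨x, hx⟩).2]; simp⟩

theorem T_mem_of_mem {g h : G} {x : R} (hx : x ∈ A.D h) : A.T g x ∈ A.D (g * h) :=
  (A.α_mem_iff _).2 ((A.D h).mul_mem_left _ _ hx)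

theorem T_e (g h : G) : A.T g (A.e h) = A.e g * A.e (g * h) := by
  have hmem : A.e g * A.e (g * h) ∈ A.D g := (A.D g).mul_mem_right _ _ (A.e_mem g)
  obtain ⟨y, hy, hyx⟩ := A.exists_T_eq hmem
  have hyh : y ∈ A.D h := by
    have : (A.α g ⟨y, hy⟩ : R) ∈ A.D (g * h) := by
      rw [← A.T_of_mem hy, hyx]; exact (A.D _).mul_mem_left _ _ (A.e_mem _)
    exact (A.α_mem_iff _).1 this
  have h1 : A.T g (A.e h) * (A.e g * A.e (g * h)) = A.T g (A.e h) := by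
    rw [← mul_assoc, A.mul_e (A.T_mem _ _), A.mul_e (A.T_mem_of_mem (A.e_mem h))]
  rw [← h1, ← hyx, ← A.T_mul, A.e_mul hyh]

theorem T_T_mul_w (g h : G) (x : R) :
    A.T g (A.T h x) * A.w g h = A.w g h * A.T (g * h) x := by
  have hx : A.e h⁻¹ * (A.e (g * h)⁻¹ * x) ∈ (A.D h⁻¹).asIdeal * (A.D (g * h)⁻¹).asIdeal :=
    A.mem_mul_iff.2 ⟨(A.D _).mul_mem_right _ _ (A.e_mem _),
      (A.D _).mul_mem_left _ _ ((A.D _).mul_mem_right _ _ (A.e_mem _))⟩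
  obtain ⟨h1, h2, h3⟩ := A.mem_dom_of_comp hx
  have key := A.α_comp g h _ hx h1 h2 h3
  rw [← A.T_of_mem h2, ← A.T_of_mem h3, ← A.T_of_mem h1, A.T_e_self, A.T_mul h, A.T_e,
    mul_inv_rev, mul_inv_cancel_left, mul_assoc (A.e h), A.e_comm h,
    mul_assoc (A.e g⁻¹), A.T_e_self, A.mul_e (A.T_mem h x),
    ← mul_inv_rev, A.T_mul (g * h) (A.e h⁻¹), A.T_e_self, A.T_e,
    mul_inv_cancel_right] at key
  have h4 : A.e (g * h) * A.e g * A.T (g * h) x * (A.e g * A.e (g * h)) =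
      A.e g * A.T (g * h) x := by
    have h5 : A.e (g * h) * A.e g * A.T (g * h) x = A.e g * A.T (g * h) x := by
      rw [A.e_comm (g * h), mul_assoc, A.e_mul (A.T_mem _ _)]
    rw [h5, mul_assoc, ← mul_assoc (A.T (g * h) x), ← A.e_comm g, mul_assoc (A.e g),
      A.mul_e (A.T_mem _ _), ← mul_assoc, A.e_idem]
  rw [key, mul_assoc, A.wInv_mul_w, mul_assoc, h4, ← mul_assoc, A.mul_e (A.w_mem_left g h)]

theorem T_mul_w_mul (g h t : G) {x : R} (hx : x ∈ A.D h) (hx' : x ∈ A.D (h * t)) :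
    A.T g (x * A.w h t) * A.w g (h * t) = A.T g x * A.w g h * A.w (g * h) t := by
  have ha : A.e g⁻¹ * x ∈ (A.D g⁻¹).asIdeal * (A.D h).asIdeal * (A.D (h * t)).asIdeal :=
    A.mem_mul_mul_iff.2 ⟨(A.D _).mul_mem_right _ _ (A.e_mem _),
      (A.D _).mul_mem_left _ _ hx, (A.D _).mul_mem_left _ _ hx'⟩
  obtain ⟨h1, h2⟩ := A.mem_dom_of_cocycle ha
  have key := A.cocycle g h t _ ha h1 h2
  rwa [← A.T_of_mem h1, ← A.T_of_mem h2, A.T_e_self, mul_assoc, A.T_e_self] at key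

/-- The partial crossed product `R *_{α,w} G`: its additive group is `⨁_{g ∈ G} D_g`, the
element `a δ_g` being `a` in the summand of index `g`. -/
def CrossedProduct : Type _ := ⨁ g, A.D g

instance : AddCommGroup A.CrossedProduct := inferInstanceAs (AddCommGroup (⨁ g, A.D g))

namespace CrossedProduct

open Classical in
/-- The homogeneous element `a δ_g`, additively in `a ∈ D_g`. -/
noncomputable def δ (g : G) : A.D g →+ A.CrossedProduct :=
  DirectSum.of (fun g => A.D g) g

/-- The coefficient `α_g(α_g⁻¹(a) b) w_{g,h}` of `(a δ_g)(b δ_h)` at `δ_{gh}`. -/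
def mulCoeff (g h : G) (a : A.D g) (b : A.D h) : A.D (g * h) :=
  ⟨A.α g ⟨(A.α g).symm a * b, (A.D g⁻¹).mul_mem_right _ _ ((A.α g).symm a).2⟩ * A.w g h,
    (A.D _).mul_mem_left _ _ (A.w_mem_right g h)⟩

theorem coe_mulCoeff (g h : G) (a : A.D g) (b : A.D h) :
    (mulCoeff A g h a b : R) = a * A.T g b * A.w g h := by
  change (A.α g ⟨(A.α g).symm a * b, _⟩ : R) * _ = _
  rw [← A.T_of_mem, A.T_mul, A.T_of_mem ((A.α g).symm a).2]
  simp

/-- `mulCoeff` as a biadditive map. -/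
def mulCoeffHom (g h : G) : A.D g →+ A.D h →+ A.D (g * h) :=
  AddMonoidHom.mk' (fun a => AddMonoidHom.mk' (mulCoeff A g h a) (by
    intro b c
    apply Subtype.ext
    have : ∀ x y : R, A.T g (x + y) = A.T g x + A.T g y := fun x y => by
      have : (⟨A.e g⁻¹ * (x + y), (A.D g⁻¹).mul_mem_right _ _ (A.e_mem _)⟩ : A.D g⁻¹) =
          ⟨A.e g⁻¹ * x, (A.D g⁻¹).mul_mem_right _ _ (A.e_mem _)⟩ +
          ⟨A.e g⁻¹ * y, (A.D g⁻¹).mul_mem_right _ _ (A.e_mem _)⟩ :=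
        Subtype.ext (mul_add _ _ _)
      unfold T
      rw [this, map_add]
      rfl
    change (mulCoeff A g h a (b + c) : R) = mulCoeff A g h a b + mulCoeff A g h a c
    simp only [coe_mulCoeff]
    rw [← add_mul, ← mul_add, ← this]
    rfl)) (by
    intro a b
    ext c
    change (mulCoeff A g h (a + b) c : R) = mulCoeff A g h a c + mulCoeff A g h b c
    simp only [coe_mulCoeff]
    rw [← add_mul, ← add_mul]
    rfl)

open Classical in
/-- The multiplication of the partial crossed product, the biadditive extension of
`(a δ_g)(b δ_h) = α_g(α_g⁻¹(a) b) w_{g,h} δ_{gh}`. -/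
noncomputable def mulHom : A.CrossedProduct →+ A.CrossedProduct →+ A.CrossedProduct :=
  DirectSum.toAddMonoid fun g => AddMonoidHom.flip <| DirectSum.toAddMonoid fun h =>
    AddMonoidHom.flip <| (AddMonoidHom.compHom (δ A (g * h))).comp (mulCoeffHom A g h)

noncomputable instance : Mul A.CrossedProduct := ⟨fun x y => mulHom A x y⟩

/-- The identity element `1_R δ_1`. -/
noncomputable instance : One A.CrossedProduct :=
  ⟨δ A 1 ⟨1, by rw [A.D_one]; trivial⟩⟩

open Classical in
theorem δ_mul_δ (g h : G) (a : A.D g) (b : A.D h) :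
    δ A g a * δ A h b = δ A (g * h) (mulCoeff A g h a b) := by
  have h1 := DirectSum.toAddMonoid_of (β := fun g => A.D g) (fun g => AddMonoidHom.flip <|
    DirectSum.toAddMonoid fun h => AddMonoidHom.flip <|
      (AddMonoidHom.compHom (δ A (g * h))).comp (mulCoeffHom A g h)) g a
  have h2 := DirectSum.toAddMonoid_of (β := fun g => A.D g) (fun h => AddMonoidHom.flip <|
      (AddMonoidHom.compHom (δ A (g * h))).comp (mulCoeffHom A g h)) h b
  exact (DFunLike.congr_fun h1 (δ A h b)).trans (DFunLike.congr_fun h2 a)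

theorem δ_congr {g h : G} (hgh : g = h) {a : A.D g} {b : A.D h} (hab : (a : R) = b) :
    δ A g a = δ A h b := by
  subst hgh
  rw [Subtype.ext hab]

open Classical in
theorem induction_on {p : A.CrossedProduct → Prop} (x : A.CrossedProduct) (zero : p 0)
    (homogeneous : ∀ g a, p (δ A g a)) (add : ∀ x y, p x → p y → p (x + y)) : p x := by
  exact DirectSum.induction_on (motive := p) x zero homogeneous add

theorem mul_add' (x y z : A.CrossedProduct) : x * (y + z) = x * y + x * z :=
  map_add (mulHom A x) y z

theorem add_mul' (x y z : A.CrossedProduct) : (x + y) * z = x * z + y * z :=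
  DFunLike.congr_fun (map_add (mulHom A) x y) z

theorem zero_mul' (x : A.CrossedProduct) : 0 * x = 0 :=
  DFunLike.congr_fun (map_zero (mulHom A)) x

theorem mul_zero' (x : A.CrossedProduct) : x * 0 = 0 := map_zero (mulHom A x)

theorem T_one_apply (x : R) : A.T 1 x = x := by
  have hx : x ∈ A.D 1⁻¹ := by rw [inv_one, A.D_one]; trivial
  rw [A.T_of_mem hx, A.α_one]

theorem mul_assoc' (x y z : A.CrossedProduct) : x * y * z = x * (y * z) := by
  induction x using induction_on with
  | zero => simp only [zero_mul']
  | add x₁ x₂ h₁ h₂ => simp only [add_mul', h₁, h₂]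
  | homogeneous g a =>
    induction y using induction_on with
    | zero => simp only [zero_mul', mul_zero']
    | add y₁ y₂ h₁ h₂ => simp only [add_mul', mul_add', h₁, h₂]
    | homogeneous h b =>
      induction z using induction_on with
      | zero => simp only [mul_zero']
      | add z₁ z₂ h₁ h₂ => simp only [mul_add', h₁, h₂]
      | homogeneous t c =>
        simp only [δ_mul_δ]
        refine δ_congr A (mul_assoc g h t) ?_
        simp only [coe_mulCoeff]
        have key := A.T_mul_w_mul g h t (A.T_mem h c) (A.T_mem_of_mem c.2)
        rw [A.T_T_mul_w] at key
        rw [mul_assoc (b : R), A.T_mul g b]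
        simp only [mul_assoc] at key ⊢
        rw [key]

theorem one_mul' (x : A.CrossedProduct) : 1 * x = x := by
  induction x using induction_on with
  | zero => exact mul_zero' A 1
  | add x₁ x₂ h₁ h₂ => rw [mul_add', h₁, h₂]
  | homogeneous g a =>
    refine (δ_mul_δ A 1 g _ a).trans (δ_congr A (one_mul g) ?_)
    rw [coe_mulCoeff, T_one_apply, A.w_one_left, one_mul, A.mul_e a.2]

theorem mul_one' (x : A.CrossedProduct) : x * 1 = x := by
  induction x using induction_on with
  | zero => exact zero_mul' A 1
  | add x₁ x₂ h₁ h₂ => rw [add_mul', h₁, h₂]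
  | homogeneous g a =>
    refine (δ_mul_δ A g 1 a _).trans (δ_congr A (mul_one g) ?_)
    rw [coe_mulCoeff, A.w_one_right, mul_assoc, A.mul_e (A.T_mem _ _)]
    have : A.T g (1 : R) = A.e g := by
      have h1 := A.T_e_self g 1
      rw [mul_one, A.T_e, mul_inv_cancel, A.mul_e (by rw [A.D_one]; trivial)] at h1
      exact h1.symm
    change (a : R) * A.T g 1 = a
    rw [this, A.mul_e a.2]

noncomputable instance : Ring A.CrossedProduct :=
  { (inferInstance : AddCommGroup A.CrossedProduct) with
    mul := (· * ·)
    one := 1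
    left_distrib := mul_add' A
    right_distrib := add_mul' A
    zero_mul := zero_mul' A
    mul_zero := mul_zero' A
    mul_assoc := mul_assoc' A
    one_mul := one_mul' A
    mul_one := mul_one' A }

end CrossedProduct

end UnitalTwistedPartialAction

/-! Both directions follow from one criterion in the style of Camps and Dicks,
`IsSemilocalRing.of_surjective_moduleEnd`: a ring acting on a finitely generated module `M` over a
semilocal ring `K` is semilocal once elements acting surjectively are left invertible. Modulo
`J(K)M` the module has finite length, where a maximal-kernel argument applies, and Nakayama's lemma
lifts surjectivity back to `M`. The crossed product `S` acts on itself by right multiplication,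
`R`-linearly, and is generated over `R` by the `1_g δ_g`; this gives one direction. For the other,
`R` acts on the cyclic left `S`-module `S` by right multiplication, and taking the `δ_1`-coefficient
turns a left inverse of `r δ_1` in `S` into one of `r` in `R`. -/

/-! ### Semilocality from an action on a module -/

theorem Ring.le_jacobson_of_forall_exists_mul_one_sub {R : Type*} [Ring R] {I : Ideal R}
    (h : ∀ x ∈ I, ∃ y, y * (1 - x) = 1) : I ≤ Ring.jacobson R := by
  rw [Ring.jacobson_eq_sInf_isMaximal]
  refine le_sInf fun m hm x hx => ?_
  by_contra hxm
  obtain ⟨y, i, hi, hy⟩ := hm.exists_inv hxm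
  obtain ⟨z, hz⟩ := h (y * x) (I.mul_mem_left y hx)
  refine hm.ne_top ((Ideal.eq_top_iff_one m).2 ?_)
  rw [← hz, show 1 - y * x = i by rw [← hy]; abel]
  exact m.mul_mem_left z hi

/-- Complements modulo the radical, lifted to `R`: the image of `K` complements the given left ideal
of the quotient. -/
theorem isSemilocalRing_of_forall_exists_sup_eq_top {R : Type*} [Ring R]
    (h : ∀ I : Ideal R, ∃ K : Ideal R, I ⊔ K = ⊤ ∧ I ⊓ K ≤ Ring.jacobson R) :
    IsSemilocalRing R := by
  let f := Ideal.Quotient.mk (Ring.jacobson R)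
  have hf : Function.Surjective f := Ideal.Quotient.mk_surjective
  refine (isSemisimpleModule_iff _ _).2 ⟨fun I => ?_⟩
  obtain ⟨K, hsup, hinf⟩ := h (Ideal.comap f I)
  refine ⟨K.map f, ?_, ?_⟩
  · rw [disjoint_iff, eq_bot_iff]
    rintro x ⟨hxI, hxK⟩
    obtain ⟨y, hy, rfl⟩ := (Ideal.mem_map_iff_of_surjective f hf).1 hxK
    exact Ideal.Quotient.eq_zero_iff_mem.2 (hinf ⟨hxI, hy⟩)
  · rw [codisjoint_iff, ← Ideal.map_comap_of_surjective f hf I, ← Ideal.map_sup, hsup,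
      Ideal.map_top]

theorem exists_mul_one_sub_mul_eq_one {R : Type*} [Ring R] {a b : R}
    (h : ∃ y, y * (1 - b * a) = 1) : ∃ y, y * (1 - a * b) = 1 := by
  obtain ⟨y, hy⟩ := h
  refine ⟨1 + a * y * b, ?_⟩
  calc (1 + a * y * b) * (1 - a * b) = 1 - a * b + a * (y * (1 - b * a)) * b := by noncomm_ring
    _ = 1 := by rw [hy, mul_one, sub_add_cancel]

/-- A ring acting from the right on a module of finite length is semilocal if the elements acting
bijectively are left invertible. -/
theorem isSemilocalRing_of_bijective_moduleEnd {K R M : Type*} [Ring K] [Ring R] [AddCommGroup M]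
    [Module K M] [IsNoetherian K M] [IsArtinian K M] (φ : Rᵐᵒᵖ →+* Module.End K M)
    (hφ : ∀ r : R, Function.Bijective (φ (.op r)) → ∃ s, s * r = 1) : IsSemilocalRing R := by
  refine isSemilocalRing_of_forall_exists_sup_eq_top fun I => ?_
  -- Among the `b` congruent to 1 modulo `I`, take one whose kernel on `M` is maximal; `R b` is then
  -- the required complement.
  obtain ⟨_, ⟨b, hb, rfl⟩, hmax⟩ := set_has_maximal_iff_noetherian.2 ‹IsNoetherian K M›
    ((fun b : R => LinearMap.ker (φ (.op b))) '' {b | 1 - b ∈ I}) ⟨_, 1, by simp, rfl⟩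
  refine ⟨Ideal.span {b}, ?_, ?_⟩
  · rw [Ideal.eq_top_iff_one, ← sub_add_cancel 1 b]
    exact Submodule.add_mem_sup hb (Ideal.mem_span_singleton_self b)
  · refine Ring.le_jacobson_of_forall_exists_mul_one_sub ?_
    rintro x ⟨hxI, hxb⟩
    obtain ⟨a, rfl⟩ := Ideal.mem_span_singleton'.1 hxb
    -- It suffices to invert `1 - b * a`. Since `a * b ∈ I`, the element `b - b * (a * b)` is again
    -- congruent to 1, so by maximality its kernel is no larger than that of `b`.
    refine exists_mul_one_sub_mul_eq_one (hφ _ ?_)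
    have hφ_sub (m : M) : φ (.op (b - b * (a * b))) m =
        φ (.op b) m - φ (.op b) (φ (.op a) (φ (.op b) m)) := by
      simp [MulOpposite.op_sub, MulOpposite.op_mul, mul_assoc]
    have hle : LinearMap.ker (φ (.op b)) ≤ LinearMap.ker (φ (.op (b - b * (a * b)))) := by
      intro m hm
      rw [LinearMap.mem_ker] at hm ⊢
      rw [hφ_sub, hm, map_zero, map_zero, sub_zero]
    have hmem : 1 - (b - b * (a * b)) ∈ I := by
      rw [← sub_add]
      exact I.add_mem hb (I.mul_mem_left b hxI)
    have heq := hle.eq_of_not_lt (hmax _ ⟨_, hmem, rfl⟩)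
    have hinj : Function.Injective (φ (.op (1 - b * a))) := by
      rw [← LinearMap.ker_eq_bot, LinearMap.ker_eq_bot']
      intro m hm
      -- A vector fixed by `b * a` is killed by `b - b * (a * b)`, hence by `b`, hence is zero.
      replace hm : m = φ (.op a) (φ (.op b) m) := by
        simpa [MulOpposite.op_sub, MulOpposite.op_mul, sub_eq_zero] using hm
      have : m ∈ LinearMap.ker (φ (.op b)) := by
        rw [heq, LinearMap.mem_ker, hφ_sub, ← hm, sub_self]
      rw [hm, LinearMap.mem_ker.1 this, map_zero]
    exact ⟨hinj, IsArtinian.surjective_of_injective_endomorphism _ hinj⟩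

theorem IsSemilocalRing.isSemisimpleModule_quotient_jacobson_smul_top {K : Type*} [Ring K]
    (hK : IsSemilocalRing K) (M : Type*) [AddCommGroup M] [Module K M] :
    IsSemisimpleModule K (M ⧸ Ring.jacobson K • (⊤ : Submodule K M)) := by
  have : IsSemisimpleRing (K ⧸ Ring.jacobson K) := hK
  let N : Submodule K M := Ring.jacobson K • ⊤
  have htors : Module.IsTorsionBySet K (M ⧸ N) (Ring.jacobson K) := by
    rintro x ⟨r, hr⟩
    obtain ⟨m, rfl⟩ := N.mkQ_surjective x
    change r • N.mkQ m = 0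
    rw [← map_smul, Submodule.mkQ_apply, Submodule.Quotient.mk_eq_zero]
    exact Submodule.smul_mem_smul hr trivial
  let := htors.module
  -- The identity, semilinear over `K → K/J(K)`, transfers semisimplicity from the quotient ring to
  -- `K`.
  let f : (M ⧸ N) →ₛₗ[Ideal.Quotient.mk (Ring.jacobson K)] (M ⧸ N) :=
    ⟨AddHom.id _, fun _ _ => rfl⟩
  exact (f.isSemisimpleModule_iff_of_bijective Function.bijective_id).2 inferInstance

/-- A ring acting from the right on a finitely generated module over a semilocal ring is semilocal
if the elements acting surjectively are left invertible. -/
theorem IsSemilocalRing.of_surjective_moduleEnd {K R M : Type*} [Ring K] [Ring R] [AddCommGroup M]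
    [Module K M] [Module.Finite K M] (hK : IsSemilocalRing K) (φ : Rᵐᵒᵖ →+* Module.End K M)
    (hφ : ∀ r : R, Function.Surjective (φ (.op r)) → ∃ s, s * r = 1) : IsSemilocalRing R := by
  let N : Submodule K M := Ring.jacobson K • ⊤
  have hN (f : Module.End K M) : N ≤ N.comap f := by
    rw [← Submodule.map_le_iff_le_comap, Submodule.map_smul'']
    exact smul_mono_right _ le_top
  have : IsSemisimpleModule K (M ⧸ N) := hK.isSemisimpleModule_quotient_jacobson_smul_top M
  refine isSemilocalRing_of_bijective_moduleEnd (K := K) (M := M ⧸ N)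
    { toFun := fun r => N.mapQ N (φ r) (hN _)
      map_one' := by ext; simp
      map_mul' := fun _ _ => by ext; simp
      map_zero' := by ext; simp
      map_add' := fun _ _ => by ext; simp } fun r hr => hφ r ?_
  let P := LinearMap.range (φ (.op r))
  -- Surjectivity modulo `N` means `M = P + J(K)M`, so the cokernel `M ⧸ P` equals `J(K)` times
  -- itself and vanishes by Nakayama.
  suffices h : (⊤ : Submodule K (M ⧸ P)) = ⊥ by
    rw [← LinearMap.range_eq_top]
    refine P.ker_mkQ.symm.trans (LinearMap.ker_eq_top.2 ?_)
    exact LinearMap.ext fun m => (Submodule.mem_bot K).1 (h ▸ Submodule.mem_top)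
  refine Module.Finite.fg_top.eq_bot_of_le_jacobson_smul fun q _ => ?_
  obtain ⟨m, rfl⟩ := P.mkQ_surjective q
  obtain ⟨x, hx⟩ := hr.2 (N.mkQ m)
  obtain ⟨m', rfl⟩ := N.mkQ_surjective x
  have hsub : m - φ (.op r) m' ∈ N := (Submodule.Quotient.eq N).1 hx.symm
  have hmk : P.mkQ m = P.mkQ (m - φ (.op r) m') := by
    rw [map_sub, eq_comm, sub_eq_self, Submodule.mkQ_apply, Submodule.Quotient.mk_eq_zero]
    exact LinearMap.mem_range_self _ m'
  have hmap := Submodule.mem_map_of_mem (f := P.mkQ) hsub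
  rw [Submodule.map_smul''] at hmap
  have hle : Ring.jacobson K • Submodule.map P.mkQ ⊤ ≤ Ring.jacobson K • ⊤ :=
    smul_mono_right _ le_top
  exact hmk ▸ hle hmap

/-! ### The crossed product as an extension of `R` -/

namespace UnitalTwistedPartialAction

variable {G R : Type*} [Group G] [Ring R] (A : UnitalTwistedPartialAction G R)

theorem mem_D_one (r : R) : r ∈ A.D 1 := by
  rw [A.D_one]; trivial

namespace CrossedProduct

/-- The embedding `r ↦ r δ_1` of `R` into the partial crossed product. -/
noncomputable def baseHom : R →+* A.CrossedProduct where
  toFun r := δ A 1 ⟨r, A.mem_D_one r⟩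
  map_one' := rfl
  map_mul' r s := by
    rw [δ_mul_δ]
    refine (δ_congr A (mul_one 1) ?_).symm
    rw [coe_mulCoeff, T_one_apply, A.w_one_left, A.mul_e (A.mem_D_one _)]
  map_zero' := map_zero (δ A 1)
  map_add' r s := map_add (δ A 1) ⟨r, A.mem_D_one r⟩ ⟨s, A.mem_D_one s⟩

/-- The coefficient of an element of the partial crossed product at `δ_1`. -/
noncomputable def coeffOne : A.CrossedProduct →+ R where
  toFun x := ((show ⨁ g, A.D g from x) 1 : A.D 1)
  map_zero' := rfl
  map_add' _ _ := rfl

open Classical in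
theorem coeffOne_δ_one (a : A.D 1) : coeffOne A (δ A 1 a) = a :=
  congrArg Subtype.val (DirectSum.of_eq_same (β := fun g => A.D g) 1 a)

open Classical in
theorem coeffOne_δ_of_ne {g : G} (hg : g ≠ 1) (a : A.D g) : coeffOne A (δ A g a) = 0 :=
  congrArg Subtype.val (DirectSum.of_eq_of_ne (β := fun g => A.D g) g 1 a hg.symm)

theorem coeffOne_one : coeffOne A 1 = 1 := coeffOne_δ_one A _

/-- Right multiplication by `r δ_1` preserves degree, and in degree 1 neither `α_1` nor `w_{1,1}`
intervenes. This right `R`-linearity is what makes `baseHom` reflect left invertibility. -/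
theorem coeffOne_mul_baseHom (x : A.CrossedProduct) (r : R) :
    coeffOne A (x * baseHom A r) = coeffOne A x * r := by
  induction x using induction_on with
  | zero => simp
  | add x y hx hy => rw [add_mul, map_add, map_add, hx, hy, add_mul]
  | homogeneous g a =>
    have hmul : δ A g a * baseHom A r =
        δ A (g * 1) (mulCoeff A g 1 a ⟨r, A.mem_D_one r⟩) := δ_mul_δ A g 1 a _
    rw [hmul]
    by_cases hg : g = 1
    · subst hg
      have hcoe : δ A (1 * 1) (mulCoeff A 1 1 a ⟨r, A.mem_D_one r⟩) =
          δ A 1 ⟨a * r, A.mem_D_one _⟩ := by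
        refine δ_congr A (mul_one 1) ?_
        rw [coe_mulCoeff, T_one_apply, A.w_one_left, A.mul_e (A.mem_D_one _)]
      rw [hcoe, coeffOne_δ_one, coeffOne_δ_one]
    · rw [coeffOne_δ_of_ne A hg, coeffOne_δ_of_ne A (by rwa [mul_one]), zero_mul]

theorem baseHom_mul_δ (g : G) (a : A.D g) : baseHom A a * δ A g ⟨A.e g, A.e_mem g⟩ = δ A g a := by
  refine (δ_mul_δ A 1 g _ _).trans (δ_congr A (one_mul g) ?_)
  rw [coe_mulCoeff, T_one_apply, A.w_one_left, A.mul_e a.2, A.mul_e a.2]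

/-- The partial crossed product as a left `R`-module through `r ↦ r δ_1`. -/
noncomputable instance : Module R A.CrossedProduct := Module.compHom _ (baseHom A)

instance : IsScalarTower R A.CrossedProduct A.CrossedProduct :=
  ⟨fun r x y => mul_assoc (baseHom A r) x y⟩

instance [Finite G] : Module.Finite R A.CrossedProduct := by
  refine ⟨Submodule.fg_def.2
    ⟨Set.range fun g => δ A g ⟨A.e g, A.e_mem g⟩, Set.finite_range _, ?_⟩⟩
  refine eq_top_iff.2 fun (x : A.CrossedProduct) _ => ?_
  induction x using induction_on with
  | zero => exact zero_mem _
  | add x y hx hy => exact add_mem (hx trivial) (hy trivial)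
  | homogeneous g a =>
    rw [← baseHom_mul_δ]
    exact Submodule.smul_mem _ (a : R) (Submodule.subset_span ⟨g, rfl⟩)

end CrossedProduct

end UnitalTwistedPartialAction

/-! ### Transfer of semilocality in both directions -/

/-- A ring that is finitely generated as a left module over a semilocal ring is semilocal. -/
theorem IsSemilocalRing.of_finite {R S : Type*} [Ring R] [Ring S] [Module R S]
    [IsScalarTower R S S] [Module.Finite R S] (hR : IsSemilocalRing R) : IsSemilocalRing S :=
  have := SMulCommClass.symm R Sᵐᵒᵖ S
  -- A preimage of 1 under right multiplication by an element is a left inverse of it.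
  hR.of_surjective_moduleEnd (Module.toModuleEnd R (S := Sᵐᵒᵖ) S) fun _ hs => hs 1

/-- Semilocality descends along a ring homomorphism that reflects left invertibility. -/
theorem IsSemilocalRing.of_ringHom {R S : Type*} [Ring R] [Ring S] (hS : IsSemilocalRing S)
    (f : R →+* S) (hf : ∀ r, (∃ t, t * f r = 1) → ∃ s, s * r = 1) : IsSemilocalRing R :=
  hS.of_surjective_moduleEnd ((Module.toModuleEnd S (S := Sᵐᵒᵖ) S).comp f.op)
    fun r hr => hf r (hr 1)

theorem mainTheorem6 {G R : Type*} [Group G] [Finite G] [Ring R]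
    (A : UnitalTwistedPartialAction G R) :
    IsSemilocalRing R ↔ IsSemilocalRing A.CrossedProduct := by
  refine ⟨fun hR => hR.of_finite, fun hS =>
    hS.of_ringHom (UnitalTwistedPartialAction.CrossedProduct.baseHom A) ?_⟩
  rintro r ⟨t, ht⟩
  refine ⟨UnitalTwistedPartialAction.CrossedProduct.coeffOne A t, ?_⟩
  rw [← UnitalTwistedPartialAction.CrossedProduct.coeffOne_mul_baseHom, ht,
    UnitalTwistedPartialAction.CrossedProduct.coeffOne_one]
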